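/- **Setting.** On Fock vectors $\psi=(\psi^{(n)})_{n\ge 0}$, $\psi^{(n)}:\mathbb R^n\to\mathbb C$, with $\langle\psi,\varphi\rangle=\sum_n\int_{\mathbb R^n}\overline{\psi^{(n)}}\varphi^{(n)}$, let $(b_t\psi)^{(n)}(s_1,\dots,s_n)=\sqrt{n+1}\,\psi^{(n+1)}(t,s_1,\dots,s_n)$, and let $b_t^\dagger$ be its formal adjoint, with $[b_t,b_s^\dagger]=\delta(t-s)$ and $[b_t,b_s]=[b_t^\dagger,b_s^\dagger]=0$. Exponential vectors are $\psi(u)=(u^{\otimes n}/\sqrt{n!})_{n\ge0}$, where $u:\mathbb R\to\mathbb C$ is measurable, square integrable and bounded on bounded sets. A right-continuous step function is a finite complex linear combination of indicators of intervals $[a,b)$. For integers $n\ge 2$ and $k$ and a right-continuous step function $f$ with $f(0)=0$, put $$\hat B^n_k(f)=\int_{\mathbb R} f(t)\,e^{\frac k2(b_t-b_t^\dagger)}\Big(\frac{b_t+b_t^\dagger}{2}\Big)^{n-1}e^{\frac k2(b_t-b_t^\dagger)}\,dt .$$ This, and likewise a product $\hat B^n_k(f)\hat B^N_K(h)$, which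 is the double integral against $f(t)h(s)$ of the product of the integrands at the times $t$ and $s$, is a quadratic form on exponential vectors, obtained as follows. Expand the exponential series and the powers; bring every term to normal order (all $b^\dagger$ to the left of all $b$) by the commutation relations, which produces powers of $\delta(t-s)$ and, from letters at equal times, of $\delta(0)$; renormalize by $$\delta^l(t-s)=\delta(s)\,\delta(t-s),\qquad l=2,3,\dots;$$ integrate against the test functions, where $(b_t^\dagger)^{a}(b_s^\dagger)^{a'}b_t^{c}b_s^{c'}$ has the quadratic form $\langle b_t^{a}b_s^{a'}\psi,\,b_t^{c}b_s^{c'}\varphi\rangle$; and sum over the terms of the exponential series. Here a factor $\delta(0)^i$, $i\ge1$, at time $t$ is read through the same prescription as the coefficient in $\delta^{i}(t'-t)\,\delta(t'-t)=\delta^{i+1}(t'-t)=\delta(t)\,\delta(t'-t)$, that is, as $\delta(t)$, and factors $\delta(0)$ that accompany $\delta^l(t-s)$ with $l\ge1$ are counted as further factors $\delta(t-s)$. **Proposition.** Let $f,g$ be right-continuous step functions with $f(0)=g(0)=0$. Then for all integers $n,N\ge2$ and all $k,K\in\mathbb Z$, as quadratic forms on exponential vectors, $$[\hat B^n_k(\bar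 g),\hat B^N_K(f)]=\big(k(N-1)-K(n-1)\big)\,\hat B^{n+N-2}_{k+K}(\bar g f),\qquad [x,y]:=xy-yx,$$ where all the series over the terms of the exponentials converge absolutely; that is, the $\hat B^n_k$ satisfy the commutation relations of the $w_\infty$ algebra. In particular, for $n=N=2$ they satisfy the Virasoro relations without central term: $$[\hat B^2_k(\bar g),\hat B^2_K(f)]=(k-K)\,\hat B^2_{k+K}(\bar g f).$$ -/

import Mathlib

open MeasureTheory

open scoped ComplexConjugate

noncomputable section

namespace WhiteNoise

/-! ### Test functions -/

/-- Right-continuous step functions on `ℝ`: finite complex linear combinations of indicators of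
bounded intervals `[a, b)`. -/
def IsRightContStep (f : ℝ → ℂ) : Prop :=
  f ∈ Submodule.span ℂ {h : ℝ → ℂ | ∃ a b : ℝ, h = (Set.Ico a b).indicator (fun _ => (1 : ℂ))}

/-! ### Fock vectors, the annihilation density and exponential vectors -/

/-- A Fock vector `ψ = (ψ⁽ⁿ⁾)` given by its pointwise defined components `ψ⁽ⁿ⁾(s₁, …, sₙ)`. -/
abbrev FockVec : Type := (n : ℕ) → (Fin n → ℝ) → ℂ

/-- The Fock scalar product `⟨ψ, φ⟩ = ∑ₙ ∫ conj ψ⁽ⁿ⁾ φ⁽ⁿ⁾`, antilinear on the left. -/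
def fockInner (ψ φ : FockVec) : ℂ :=
  ∑' n : ℕ, ∫ s : Fin n → ℝ, conj (ψ n s) * φ n s

/-- `(b_t ψ)⁽ⁿ⁾(s₁, …, sₙ) = √(n+1) ψ⁽ⁿ⁺¹⁾(t, s₁, …, sₙ)`. -/
def annihilate (t : ℝ) (ψ : FockVec) : FockVec :=
  fun n s => (Real.sqrt ((n : ℝ) + 1) : ℂ) * ψ (n + 1) (Fin.cons (α := fun _ => ℝ) t s)

/-- The exponential vector `ψ(u)`, with components `u^{⊗ n} / √n!`. -/
def expVec (u : ℝ → ℂ) : FockVec :=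
  fun n s => (∏ i, u (s i)) / (Real.sqrt (n.factorial : ℝ) : ℂ)

/-- The functions whose exponential vectors are used: measurable, square integrable and bounded on
bounded sets (among them all Schwartz functions and all step functions). -/
def IsExpArg (u : ℝ → ℂ) : Prop :=
  Measurable u ∧ MemLp u 2 volume ∧ ∀ R : ℝ, ∃ C : ℝ, ∀ t : ℝ, |t| ≤ R → ‖u t‖ ≤ C

/-! ### White noise words and normal ordering

`ι` labels the times that occur in an expression. -/

/-- The letters `b_{t_i}` and `b_{t_i}^†`. -/
inductive Gen (ι : Type) : Type
  | ann (i : ι) : Gen ι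
  | cre (i : ι) : Gen ι

/-- The (commuting) symbols occurring in normally ordered expressions: the letters, and the symbols
`δ(t_i - t_j) = δ(t_j - t_i)`. -/
abbrev Var (ι : Type) : Type := Gen ι ⊕ Sym2 ι

/-- Normally ordered expressions: the monomial with exponents `d` stands for the product of the
`δ(t_i - t_j)^{d(δ_ij)}`, followed by all `b_{t_i}^†`, followed by all `b_{t_i}`. -/
abbrev NormalExpr (ι : Type) : Type := MvPolynomial (Var ι) ℂ

/-- The letters of a normally ordered expression. -/
def symAnn {ι : Type} (i : ι) : Var ι := Sum.inl (Gen.ann i)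

/-- See `symAnn`. -/
def symCre {ι : Type} (i : ι) : Var ι := Sum.inl (Gen.cre i)

/-- The symbol `δ(t_i - t_j)`. -/
def symDelta {ι : Type} (i j : ι) : Var ι := Sum.inr s(i, j)

/-- Left multiplication of a normally ordered expression by a letter, brought back to normal order
with the commutation relations `[b_{t_i}, b_{t_j}^†] = δ(t_i - t_j)`,
`[b_{t_i}, b_{t_j}] = [b_{t_i}^†, b_{t_j}^†] = 0`. -/
def leftMul {ι : Type} [Fintype ι] : Gen ι → Module.End ℂ (NormalExpr ι)
  | Gen.cre i => LinearMap.mulLeft ℂ (MvPolynomial.X (symCre i))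
  | Gen.ann i => LinearMap.mulLeft ℂ (MvPolynomial.X (symAnn i)) +
      ∑ j, LinearMap.mulLeft ℂ (MvPolynomial.X (symDelta i j)) ∘ₗ
        (MvPolynomial.pderiv (symCre j) : Derivation ℂ (NormalExpr ι) (NormalExpr ι)).toLinearMap

/-- The normally ordered form of a noncommutative polynomial in the `b_{t_i}`, `b_{t_i}^†`. -/
def normalOrder {ι : Type} [Fintype ι] (w : FreeAlgebra ℂ (Gen ι)) : NormalExpr ι :=
  FreeAlgebra.lift ℂ (leftMul (ι := ι)) w 1

/-- `leftMul` represents the relation `[b_{t_i}, b_{t_j}^†] = δ(t_i - t_j)`. -/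
theorem leftMul_ann_cre {ι : Type} [Fintype ι] (i j : ι) (P : NormalExpr ι) :
    leftMul (Gen.ann i) (leftMul (Gen.cre j) P) - leftMul (Gen.cre j) (leftMul (Gen.ann i) P) =
      MvPolynomial.X (symDelta i j) * P := by
  classical
  have key : ∀ x : ι,
      MvPolynomial.pderiv (symCre x)
        ((MvPolynomial.X (symCre j) : NormalExpr ι) * P) =
      MvPolynomial.X (symCre j) * MvPolynomial.pderiv (symCre x) P + if x = j then P else 0 := by
    intro x
    by_cases h : x = j
    · subst h
      simp [Derivation.leibniz]
    · have h' : symCre j ≠ symCre x := by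
        simp only [symCre, ne_eq, Sum.inl.injEq, Gen.cre.injEq]
        exact fun e => h e.symm
      simp [Derivation.leibniz, MvPolynomial.pderiv_X_of_ne h', h]
  simp only [leftMul, LinearMap.add_apply, LinearMap.mulLeft_apply, LinearMap.sum_apply,
    LinearMap.comp_apply, Derivation.coeFn_coe, key, mul_add, Finset.sum_add_distrib,
    Finset.mul_sum, mul_ite, mul_zero, Finset.sum_ite_eq', Finset.mem_univ, if_true]
  simp only [mul_left_comm (MvPolynomial.X (symCre j))]
  ring

/-! ### The expansion of the integrand -/

/-- `b_{t_i}` as a noncommutative polynomial. -/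
def ann {ι : Type} (i : ι) : FreeAlgebra ℂ (Gen ι) := FreeAlgebra.ι ℂ (Gen.ann i)

/-- `b_{t_i}^†` as a noncommutative polynomial. -/
def cre {ι : Type} (i : ι) : FreeAlgebra ℂ (Gen ι) := FreeAlgebra.ι ℂ (Gen.cre i)

/-- The term of order `p` of the exponential series of `(k/2)(b_{t_i} - b_{t_i}^†)`. -/
def expTerm {ι : Type} (i : ι) (k : ℤ) (p : ℕ) : FreeAlgebra ℂ (Gen ι) :=
  ((p.factorial : ℂ)⁻¹) • (((k : ℂ) / 2) • (ann i - cre i)) ^ p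

/-- The term of order `(p, q)` in the expansion of the two exponential series in
`e^{(k/2)(b - b^†)} ((b + b^†)/2)^{n-1} e^{(k/2)(b - b^†)}` at the time `t_i`. -/
def densityTerm {ι : Type} (i : ι) (n : ℕ) (k : ℤ) (pq : ℕ × ℕ) : FreeAlgebra ℂ (Gen ι) :=
  expTerm i k pq.1 * ((1 / 2 : ℂ) • (ann i + cre i)) ^ (n - 1) * expTerm i k pq.2

/-! ### Renormalization, integration against test functions, quadratic forms -/

/-- The factor `φ^m(s) ds` of the prescription `δ^{m+1}(t - s) = φ^m(s) δ(t - s)`, where `φ^m = δ`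
for `m ≥ 1`, that is, `δ^l(t - s) = δ(s) δ(t - s)` for `l ≥ 2`. -/
def renormFactor (m : ℕ) : Measure ℝ :=
  if m = 0 then volume else Measure.dirac 0

/-- The quadratic form of a normally ordered monomial at one time `t`, renormalized and integrated
against `f(t)`. The monomial is `δ(t - t)^i (b_t^†)^a (b_t)^c`; as the coefficient `δ(t' - t)^i` of
`δ(t' - t)` in a double integral over `t', t`, the factor `δ(t - t)^i` is read as `φ^i(t)`. The
quadratic form of `(b_t^†)^a (b_t)^c` is `⟨b_t^a ψ, b_t^c φ⟩`. -/
def monomialForm₁ (f : ℝ → ℂ) (ψ φ : FockVec) (d : Var (Fin 1) →₀ ℕ) : ℂ :=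
  ∫ t, f t * fockInner ((annihilate t)^[d (symCre 0)] ψ) ((annihilate t)^[d (symAnn 0)] φ)
    ∂(renormFactor (d (symDelta 0 0)))

/-- `⟨ψ, (b_t^†)^a (b_s^†)^{a'} (b_t)^c (b_s)^{c'} φ⟩` for the letters of a monomial at the two
times `t` (label `0`) and `s` (label `1`). -/
def twoTimeForm (ψ φ : FockVec) (d : Var (Fin 2) →₀ ℕ) (t s : ℝ) : ℂ :=
  fockInner ((annihilate t)^[d (symCre 0)] ((annihilate s)^[d (symCre 1)] ψ))
    ((annihilate t)^[d (symAnn 0)] ((annihilate s)^[d (symAnn 1)] φ))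

/-- The quadratic form of a normally ordered monomial at two times `t, s`, renormalized and
integrated against `f(t) h(s)`. The delta factors are `δ(t-t)^i δ(s-s)^j δ(t-s)^l`. If `l = 0` they
are read as `φ^i(t) φ^j(s)`. If `l ≥ 1` they are `δ^{i+j+l}(t-s) = φ^{i+j+l-1}(s) δ(t-s)`. -/
def monomialForm₂ (f h : ℝ → ℂ) (ψ φ : FockVec) (d : Var (Fin 2) →₀ ℕ) : ℂ :=
  if d (symDelta 0 1) = 0 then
    ∫ t, ∫ s, f t * h s * twoTimeForm ψ φ d t s
      ∂(renormFactor (d (symDelta 1 1))) ∂(renormFactor (d (symDelta 0 0)))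
  else
    ∫ s, f s * h s * twoTimeForm ψ φ d s s
      ∂(renormFactor (d (symDelta 0 0) + d (symDelta 1 1) + d (symDelta 0 1) - 1))

/-- Linear extension of `monomialForm₁` to normally ordered expressions. -/
def exprForm₁ (f : ℝ → ℂ) (P : NormalExpr (Fin 1)) (ψ φ : FockVec) : ℂ :=
  ∑ d ∈ P.support, P.coeff d * monomialForm₁ f ψ φ d

/-- Linear extension of `monomialForm₂` to normally ordered expressions. -/
def exprForm₂ (f h : ℝ → ℂ) (P : NormalExpr (Fin 2)) (ψ φ : FockVec) : ℂ :=
  ∑ d ∈ P.support, P.coeff d * monomialForm₂ f h ψ φ d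

/-! ### The operators and their products as quadratic forms -/

/-- The terms of the expansion of `⟨ψ, B̂ⁿ_k(f) φ⟩`: expand, bring to normal order, renormalize,
integrate against `f`. -/
def BhatTerm (n : ℕ) (k : ℤ) (f : ℝ → ℂ) (ψ φ : FockVec) (pq : ℕ × ℕ) : ℂ :=
  exprForm₁ f (normalOrder (densityTerm 0 n k pq)) ψ φ

/-- `⟨ψ, B̂ⁿ_k(f) φ⟩`, where `B̂ⁿ_k(f)` is the integral of
`f(t) e^{(k/2)(b_t - b_t^†)} ((b_t + b_t^†)/2)^{n-1} e^{(k/2)(b_t - b_t^†)}`. -/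
def Bhat (n : ℕ) (k : ℤ) (f : ℝ → ℂ) (ψ φ : FockVec) : ℂ :=
  ∑' pq : ℕ × ℕ, BhatTerm n k f ψ φ pq

/-- The terms of the expansion of `⟨ψ, B̂ⁿ_k(f) B̂ᴺ_K(h) φ⟩`: the product of the integrands, the
first at time `t` and the second at time `s`, is expanded, brought to normal order, renormalized and
integrated against `f(t) h(s)`. -/
def BhatMulTerm (n : ℕ) (k : ℤ) (f : ℝ → ℂ) (N : ℕ) (K : ℤ) (h : ℝ → ℂ) (ψ φ : FockVec)
    (r : (ℕ × ℕ) × (ℕ × ℕ)) : ℂ :=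
  exprForm₂ f h (normalOrder (densityTerm 0 n k r.1 * densityTerm 1 N K r.2)) ψ φ

/-- `⟨ψ, B̂ⁿ_k(f) B̂ᴺ_K(h) φ⟩`. -/
def BhatMul (n : ℕ) (k : ℤ) (f : ℝ → ℂ) (N : ℕ) (K : ℤ) (h : ℝ → ℂ) (ψ φ : FockVec) : ℂ :=
  ∑' r : (ℕ × ℕ) × (ℕ × ℕ), BhatMulTerm n k f N K h ψ φ r

/-- `⟨ψ, [B̂ⁿ_k(f), B̂ᴺ_K(h)] φ⟩` with `[x, y] = x y - y x`. -/
def BhatComm (n : ℕ) (k : ℤ) (f : ℝ → ℂ) (N : ℕ) (K : ℤ) (h : ℝ → ℂ) (ψ φ : FockVec) : ℂ :=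
  BhatMul n k f N K h ψ φ - BhatMul N K h n k f ψ φ

end WhiteNoise

end

noncomputable section

namespace WhiteNoise

/-! Exponential vectors are eigenvectors of every `b_t`. A normally ordered monomial in the letters
therefore has the form `⟨ψ(u), ψ(v)⟩` times its value at the numbers `b_t ↦ v(t)`, `b_t^† ↦ conj (u
t)`. Since the test functions vanish at `0`, every term renormalized to a Dirac mass at `0`
contributes nothing. What survives of an expression `P` at two times is its part free of deltas,
integrated over both times, and the coefficient of a single `δ(t - s)`, integrated over the diagonal
(`exprForm₂_expVec`). These are the values at "all deltas `= 0`" of `P` and of `∂P/∂δ(t - s)`.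

With all deltas `0` normal ordering is invisible, so the first part is the product of the
commutative symbols of the two factors (`symbol_normalOrder`). It is symmetric and drops out of the
commutator. The coefficient of a single `δ(t - s)` comes from one contraction of a `b_t` in the left
factor with a `b_s^†` in the right one, hence equals `∂F/∂b · ∂G/∂b^†`
(`symbol_pderiv_symDelta_normalOrder`). The commutator is thus the integrated Poisson bracket of the
symbols `e^{k(x-y)} ((x+y)/2)^{n-1}` and `e^{K(x-y)} ((x+y)/2)^{N-1}`, which is `k(N-1) - K(n-1)`
times the symbol with parameters `n+N-2`, `k+K` (`BhatComm_expVec`).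

All this is done for each term of the exponential series. The sums are then taken inside the
integrals, with series dominated uniformly on the bounded support of the test function. -/

/-! ### Symbols of normally ordered expressions -/

/-- The values of the symbols when the letters are replaced by numbers and all deltas by `0`. -/
def symbolPoint {ι : Type} (x y : ι → ℂ) : Var ι → ℂ
  | Sum.inl (Gen.ann i) => x i
  | Sum.inl (Gen.cre i) => y i
  | Sum.inr _ => 0

/-- The symbol of a normally ordered expression: letters become numbers, deltas become `0`. -/
def symbol {ι : Type} (x y : ι → ℂ) : NormalExpr ι →ₐ[ℂ] ℂ :=
  MvPolynomial.aeval (symbolPoint x y)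

/-- Evaluation of a noncommutative polynomial at commuting values of the letters. -/
def letterEval {ι : Type} {R : Type} [CommRing R] [Algebra ℂ R] (X Y : ι → R) :
    FreeAlgebra ℂ (Gen ι) →ₐ[ℂ] R :=
  FreeAlgebra.lift ℂ fun
    | Gen.ann i => X i
    | Gen.cre i => Y i

section symbol

variable {ι : Type} (x y : ι → ℂ)

@[simp] lemma symbol_symAnn (i : ι) : symbol x y (MvPolynomial.X (symAnn i)) = x i := by
  simp [symbol, symAnn, symbolPoint]

@[simp] lemma symbol_symCre (i : ι) : symbol x y (MvPolynomial.X (symCre i)) = y i := by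
  simp [symbol, symCre, symbolPoint]

@[simp] lemma symbol_symDelta (i j : ι) : symbol x y (MvPolynomial.X (symDelta i j)) = 0 := by
  simp [symbol, symDelta, symbolPoint]

lemma leftMul_cre_apply [Fintype ι] (i : ι) (P : NormalExpr ι) :
    leftMul (Gen.cre i) P = MvPolynomial.X (symCre i) * P := rfl

lemma leftMul_ann_apply [Fintype ι] (i : ι) (P : NormalExpr ι) :
    leftMul (Gen.ann i) P = MvPolynomial.X (symAnn i) * P +
      ∑ j, MvPolynomial.X (symDelta i j) * MvPolynomial.pderiv (symCre j) P := by
  simp [leftMul]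

lemma symbol_leftMul_cre [Fintype ι] (i : ι) (P : NormalExpr ι) :
    symbol x y (leftMul (Gen.cre i) P) = y i * symbol x y P := by
  simp [leftMul_cre_apply]

lemma symbol_leftMul_ann [Fintype ι] (i : ι) (P : NormalExpr ι) :
    symbol x y (leftMul (Gen.ann i) P) = x i * symbol x y P := by
  simp [leftMul_ann_apply]

/-- Each contraction produced by `leftMul` carries a delta, which the symbol kills, so a letter acts
as multiplication by its value. `P` is arbitrary so that the induction passes through products. -/
lemma symbol_lift_leftMul [Fintype ι] (w : FreeAlgebra ℂ (Gen ι)) (P : NormalExpr ι) :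
    symbol x y (FreeAlgebra.lift ℂ (leftMul (ι := ι)) w P) = letterEval x y w * symbol x y P := by
  induction w using FreeAlgebra.induction generalizing P with
  | grade0 r => simp [Module.algebraMap_end_apply]
  | grade1 g =>
    cases g <;> simp [symbol_leftMul_cre, symbol_leftMul_ann, letterEval]
  | mul a b ha hb => simp [ha, hb, mul_assoc]
  | add a b ha hb => simp [ha, hb, add_mul]

lemma symbol_normalOrder [Fintype ι] (w : FreeAlgebra ℂ (Gen ι)) :
    symbol x y (normalOrder w) = letterEval x y w := by
  simp [normalOrder, symbol_lift_leftMul]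

lemma symCre_ne_symAnn (i j : ι) : symCre i ≠ symAnn j := by simp [symCre, symAnn]
lemma symCre_ne_symDelta (i j l : ι) : symCre i ≠ symDelta j l := by simp [symCre, symDelta]
lemma symAnn_ne_symDelta (i j l : ι) : symAnn i ≠ symDelta j l := by simp [symAnn, symDelta]

end symbol

/-- The terms of `e^{z} m^a e^{z}` in the expansion of the two exponentials. -/
def expTerms (a : ℕ) (z m : ℂ) (pq : ℕ × ℕ) : ℂ :=
  (z ^ pq.1 / pq.1.factorial) * m ^ a * (z ^ pq.2 / pq.2.factorial)

/-- The derivative of `expTerms a z m` in the direction `(κ, μ)`. -/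
def expTermsDeriv (a : ℕ) (κ μ z m : ℂ) (pq : ℕ × ℕ) : ℂ :=
  κ * m ^ a * ((pq.1 * z ^ (pq.1 - 1) / pq.1.factorial) * (z ^ pq.2 / pq.2.factorial)) +
  κ * m ^ a * ((z ^ pq.1 / pq.1.factorial) * (pq.2 * z ^ (pq.2 - 1) / pq.2.factorial)) +
  μ * a * m ^ (a - 1) * ((z ^ pq.1 / pq.1.factorial) * (z ^ pq.2 / pq.2.factorial))

lemma letterEval_densityTerm {ι R : Type} [CommRing R] [Algebra ℂ R] (X Y : ι → R) (i : ι) (n : ℕ)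
    (k : ℤ) (pq : ℕ × ℕ) :
    letterEval X Y (densityTerm i n k pq) =
      ((pq.1.factorial : ℂ)⁻¹ • (((k : ℂ) / 2) • (X i - Y i)) ^ pq.1) *
        ((1 / 2 : ℂ) • (X i + Y i)) ^ (n - 1) *
        ((pq.2.factorial : ℂ)⁻¹ • (((k : ℂ) / 2) • (X i - Y i)) ^ pq.2) := by
  simp only [densityTerm, expTerm, map_mul, map_smul, map_pow, map_sub, map_add]
  simp [letterEval, ann, cre]

lemma letterEval_densityTerm_complex {ι : Type} (x y : ι → ℂ) (i : ι) (n : ℕ) (k : ℤ)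
    (pq : ℕ × ℕ) :
    letterEval x y (densityTerm i n k pq) =
      expTerms (n - 1) (k / 2 * (x i - y i)) ((x i + y i) / 2) pq := by
  rw [letterEval_densityTerm, expTerms]
  simp only [smul_eq_mul]
  ring

/-- The `ε`-part of an evaluation at dual numbers is the directional derivative. The factors `p` in
`expTermsDeriv` make the truncated exponents `p - 1` harmless at `p = 0`. -/
lemma snd_letterEval_densityTerm {ι : Type} (X Y : ι → DualNumber ℂ) (i : ι) (n : ℕ)
    (k : ℤ) (pq : ℕ × ℕ) :
    (letterEval X Y (densityTerm i n k pq)).snd =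
      expTermsDeriv (n - 1) (k / 2 * ((X i).snd - (Y i).snd)) (((X i).snd + (Y i).snd) / 2)
        (k / 2 * ((X i).fst - (Y i).fst)) (((X i).fst + (Y i).fst) / 2) pq := by
  rw [letterEval_densityTerm, expTermsDeriv]
  simp only [TrivSqZeroExt.snd_mul, TrivSqZeroExt.fst_mul, TrivSqZeroExt.fst_smul,
    TrivSqZeroExt.fst_pow, TrivSqZeroExt.snd_smul, TrivSqZeroExt.snd_pow,
    TrivSqZeroExt.fst_sub, TrivSqZeroExt.fst_add, TrivSqZeroExt.snd_sub, TrivSqZeroExt.snd_add,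
    smul_eq_mul, MulOpposite.smul_eq_mul_unop, MulOpposite.unop_op, nsmul_eq_mul, Nat.pred_eq_sub_one]
  ring

/-! ### The part of a product of two densities that is linear in `δ(t - s)` -/

/-- Allows induction over polynomials in the letters of a single time. -/
lemma densityTerm_mem_adjoin {ι : Type} (i : ι) (n : ℕ) (k : ℤ) (pq : ℕ × ℕ) :
    densityTerm i n k pq ∈ Algebra.adjoin ℂ {ann i, cre i} := by
  have ha : ann i ∈ Algebra.adjoin ℂ {ann i, cre i} := Algebra.subset_adjoin (by simp)
  have hc : cre i ∈ Algebra.adjoin ℂ {ann i, cre i} := Algebra.subset_adjoin (by simp)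
  have he (p : ℕ) : expTerm i k p ∈ Algebra.adjoin ℂ {ann i, cre i} :=
    Subalgebra.smul_mem _ (pow_mem (Subalgebra.smul_mem _ (sub_mem ha hc) _) _) _
  exact mul_mem (mul_mem (he _) (pow_mem (Subalgebra.smul_mem _ (add_mem ha hc) _) _)) (he _)

section twoTimes

variable (x y : Fin 2 → ℂ)

/-- Differentiating by a creation letter leaves the delta of each contraction in place, so no
contraction reaches the symbol. -/
lemma symbol_pderiv_symCre_leftMul_ann (i j : Fin 2) (P : NormalExpr (Fin 2)) :
    symbol x y (MvPolynomial.pderiv (symCre j) (leftMul (Gen.ann i) P)) =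
      x i * symbol x y (MvPolynomial.pderiv (symCre j) P) := by
  simp [leftMul_ann_apply, Derivation.leibniz,
    MvPolynomial.pderiv_X_of_ne (symCre_ne_symAnn _ _).symm,
    MvPolynomial.pderiv_X_of_ne (symCre_ne_symDelta _ _ _).symm]

lemma symbol_pderiv_symCre_leftMul_cre_of_ne {i j : Fin 2} (h : i ≠ j) (P : NormalExpr (Fin 2)) :
    symbol x y (MvPolynomial.pderiv (symCre j) (leftMul (Gen.cre i) P)) =
      y i * symbol x y (MvPolynomial.pderiv (symCre j) P) := by
  have h' : symCre i ≠ symCre j := by simpa [symCre] using h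
  simp [leftMul_cre_apply, Derivation.leibniz, MvPolynomial.pderiv_X_of_ne h']

lemma symbol_pderiv_symCre_leftMul_cre_self (i : Fin 2) (P : NormalExpr (Fin 2)) :
    symbol x y (MvPolynomial.pderiv (symCre i) (leftMul (Gen.cre i) P)) =
      y i * symbol x y (MvPolynomial.pderiv (symCre i) P) + symbol x y P := by
  simp [leftMul_cre_apply, Derivation.leibniz]

lemma symbol_pderiv_symDelta_leftMul_cre (i : Fin 2) (P : NormalExpr (Fin 2)) :
    symbol x y (MvPolynomial.pderiv (symDelta 0 1) (leftMul (Gen.cre i) P)) =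
      y i * symbol x y (MvPolynomial.pderiv (symDelta 0 1) P) := by
  simp [leftMul_cre_apply, Derivation.leibniz,
    MvPolynomial.pderiv_X_of_ne (symCre_ne_symDelta _ _ _)]

/-- The extra term is the contraction of `b_t` with `b_s^†`, whose `δ(t - s)` the derivative
removes. The contraction at equal times keeps its `δ(0)` and vanishes. -/
lemma symbol_pderiv_symDelta_leftMul_ann_zero (P : NormalExpr (Fin 2)) :
    symbol x y (MvPolynomial.pderiv (symDelta 0 1) (leftMul (Gen.ann 0) P)) =
      x 0 * symbol x y (MvPolynomial.pderiv (symDelta 0 1) P) +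
        symbol x y (MvPolynomial.pderiv (symCre 1) P) := by
  have h : (symDelta 0 0 : Var (Fin 2)) ≠ symDelta 0 1 := by simp [symDelta]
  simp [leftMul_ann_apply, Derivation.leibniz, MvPolynomial.pderiv_X_of_ne h,
    MvPolynomial.pderiv_X_of_ne (symAnn_ne_symDelta _ _ _)]

lemma symbol_pderiv_symDelta_leftMul_ann_one (P : NormalExpr (Fin 2)) :
    symbol x y (MvPolynomial.pderiv (symDelta 0 1) (leftMul (Gen.ann 1) P)) =
      x 1 * symbol x y (MvPolynomial.pderiv (symDelta 0 1) P) +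
        symbol x y (MvPolynomial.pderiv (symCre 0) P) := by
  have h : (symDelta 1 1 : Var (Fin 2)) ≠ symDelta 0 1 := by simp [symDelta]
  have h' : (symDelta 1 0 : Var (Fin 2)) = symDelta 0 1 := by simp [symDelta, Sym2.eq_swap]
  simp [leftMul_ann_apply, Derivation.leibniz, MvPolynomial.pderiv_X_of_ne h, h',
    MvPolynomial.pderiv_X_of_ne (symAnn_ne_symDelta _ _ _)]

/-- Left multiplication by letters at time `t` acts on the pair of derivatives by a triangular
matrix with entries `α.fst`, `α.snd`. Composing such matrices is multiplication of dual numbers,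
with `ε` recording the derivative by `b_t`. -/
lemma symbol_pderiv_lift_of_mem_adjoin_zero {A : FreeAlgebra ℂ (Gen (Fin 2))}
    (hA : A ∈ Algebra.adjoin ℂ {ann 0, cre 0}) (P : NormalExpr (Fin 2)) :
    let α := letterEval (fun i => TrivSqZeroExt.inl (x i) + DualNumber.eps)
      (fun i => (TrivSqZeroExt.inl (y i) : DualNumber ℂ)) A
    symbol x y (MvPolynomial.pderiv (symCre 1) (FreeAlgebra.lift ℂ leftMul A P)) =
        α.fst * symbol x y (MvPolynomial.pderiv (symCre 1) P) ∧
      symbol x y (MvPolynomial.pderiv (symDelta 0 1) (FreeAlgebra.lift ℂ leftMul A P)) =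
        α.fst * symbol x y (MvPolynomial.pderiv (symDelta 0 1) P) +
          α.snd * symbol x y (MvPolynomial.pderiv (symCre 1) P) := by
  induction hA using Algebra.adjoin_induction generalizing P with
  | mem a ha =>
    obtain rfl | rfl := ha
    · simp [ann, letterEval, symbol_pderiv_symCre_leftMul_ann,
        symbol_pderiv_symDelta_leftMul_ann_zero]
    · simp [cre, letterEval, symbol_pderiv_symCre_leftMul_cre_of_ne,
        symbol_pderiv_symDelta_leftMul_cre]
  | algebraMap r => simp [Module.algebraMap_end_apply, TrivSqZeroExt.algebraMap_eq_inl]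
  | add a b _ _ ha hb =>
    simp only [map_add, LinearMap.add_apply, ha, hb, TrivSqZeroExt.fst_add, TrivSqZeroExt.snd_add]
    constructor <;> ring
  | mul a b _ _ ha hb =>
    simp only [map_mul, Module.End.mul_apply, ha, hb, TrivSqZeroExt.fst_mul,
      TrivSqZeroExt.snd_mul, smul_eq_mul, MulOpposite.smul_eq_mul_unop, MulOpposite.unop_op]
    constructor <;> ring

/-- Here `ε` records the derivative by `b_s^†`. The condition `hP` excludes contractions of `b_s`
with a `b_t^†` to its right. It is preserved, and it holds for `P = 1`. -/
lemma symbol_pderiv_lift_of_mem_adjoin_one {B : FreeAlgebra ℂ (Gen (Fin 2))}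
    (hB : B ∈ Algebra.adjoin ℂ {ann 1, cre 1}) (P : NormalExpr (Fin 2))
    (hP : symbol x y (MvPolynomial.pderiv (symCre 0) P) = 0) :
    let β := letterEval (fun i => (TrivSqZeroExt.inl (x i) : DualNumber ℂ))
      (fun i => TrivSqZeroExt.inl (y i) + DualNumber.eps) B
    symbol x y (FreeAlgebra.lift ℂ leftMul B P) = β.fst * symbol x y P ∧
    symbol x y (MvPolynomial.pderiv (symCre 0) (FreeAlgebra.lift ℂ leftMul B P)) = 0 ∧
    symbol x y (MvPolynomial.pderiv (symCre 1) (FreeAlgebra.lift ℂ leftMul B P)) =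
        β.fst * symbol x y (MvPolynomial.pderiv (symCre 1) P) + β.snd * symbol x y P ∧
      symbol x y (MvPolynomial.pderiv (symDelta 0 1) (FreeAlgebra.lift ℂ leftMul B P)) =
        β.fst * symbol x y (MvPolynomial.pderiv (symDelta 0 1) P) := by
  induction hB using Algebra.adjoin_induction generalizing P with
  | mem a ha =>
    obtain rfl | rfl := ha
    · simp [ann, letterEval, symbol_pderiv_symCre_leftMul_ann, hP,
        symbol_pderiv_symDelta_leftMul_ann_one, symbol_leftMul_ann]
    · simp [cre, letterEval, symbol_pderiv_symCre_leftMul_cre_of_ne, hP,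
        symbol_pderiv_symCre_leftMul_cre_self,
        symbol_pderiv_symDelta_leftMul_cre, symbol_leftMul_cre]
  | algebraMap r => simp [Module.algebraMap_end_apply, TrivSqZeroExt.algebraMap_eq_inl, hP]
  | add a b _ _ ha hb =>
    obtain ⟨a1, a2, a3, a4⟩ := ha P hP
    obtain ⟨b1, b2, b3, b4⟩ := hb P hP
    simp only [map_add, LinearMap.add_apply, TrivSqZeroExt.fst_add, TrivSqZeroExt.snd_add,
      a1, a2, a3, a4, b1, b2, b3, b4]
    refine ⟨?_, ?_, ?_, ?_⟩ <;> ring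
  | mul a b _ _ ha hb =>
    obtain ⟨b1, b2, b3, b4⟩ := hb P hP
    obtain ⟨a1, a2, a3, a4⟩ := ha _ b2
    simp only [map_mul, Module.End.mul_apply, TrivSqZeroExt.fst_mul,
      TrivSqZeroExt.snd_mul, smul_eq_mul, MulOpposite.smul_eq_mul_unop, MulOpposite.unop_op,
      a1, a2, a3, a4, b1, b3, b4, true_and]
    refine ⟨?_, ?_, ?_⟩ <;> ring

/-- The coefficient of `δ(t - s)` in the product of two densities is the product of the derivative
of the first by `b_t` and the derivative of the second by `b_s^†`. -/
lemma symbol_pderiv_symDelta_normalOrder (n N : ℕ) (k K : ℤ) (r : (ℕ × ℕ) × (ℕ × ℕ)) :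
    symbol x y (MvPolynomial.pderiv (symDelta 0 1)
        (normalOrder (densityTerm 0 n k r.1 * densityTerm 1 N K r.2))) =
      expTermsDeriv (n - 1) (k / 2) (1 / 2) (k / 2 * (x 0 - y 0)) ((x 0 + y 0) / 2) r.1 *
        expTermsDeriv (N - 1) (-(K / 2)) (1 / 2) (K / 2 * (x 1 - y 1)) ((x 1 + y 1) / 2) r.2 := by
  obtain ⟨-, -, b3, b4⟩ := symbol_pderiv_lift_of_mem_adjoin_one x y
    (densityTerm_mem_adjoin 1 N K r.2) 1 (by simp)
  obtain ⟨-, a2⟩ := symbol_pderiv_lift_of_mem_adjoin_zero x y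
    (densityTerm_mem_adjoin 0 n k r.1) (FreeAlgebra.lift ℂ leftMul (densityTerm 1 N K r.2) 1)
  rw [normalOrder, map_mul, Module.End.mul_apply, a2, b3, b4, snd_letterEval_densityTerm,
    snd_letterEval_densityTerm]
  simp [mul_neg]

end twoTimes

/-! ### Annihilation of exponential vectors -/

lemma annihilate_smul (t : ℝ) (c : ℂ) (ψ : FockVec) :
    annihilate t (c • ψ) = c • annihilate t ψ := by
  ext n s
  simp only [annihilate, Pi.smul_apply, smul_eq_mul]
  ring

lemma annihilate_expVec (t : ℝ) (u : ℝ → ℂ) : annihilate t (expVec u) = u t • expVec u := by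
  ext n s
  have h1 : (Real.sqrt ((n : ℝ) + 1) : ℂ) ≠ 0 := by
    exact_mod_cast (Real.sqrt_pos.2 (by positivity)).ne'
  have h2 : (Real.sqrt ((n + 1).factorial : ℝ) : ℂ) =
      (Real.sqrt ((n : ℝ) + 1) : ℂ) * (Real.sqrt (n.factorial : ℝ) : ℂ) := by
    rw [Nat.factorial_succ, Nat.cast_mul, Real.sqrt_mul (by positivity)]
    push_cast
    rfl
  simp only [annihilate, expVec, Pi.smul_apply, smul_eq_mul, Fin.prod_univ_succ, Fin.cons_zero,
    Fin.cons_succ, h2]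
  field_simp

lemma iterate_annihilate_smul_expVec (t : ℝ) (u : ℝ → ℂ) (c : ℂ) (a : ℕ) :
    (annihilate t)^[a] (c • expVec u) = (u t ^ a * c) • expVec u := by
  induction a with
  | zero => simp
  | succ a ih =>
    rw [Function.iterate_succ_apply', ih, annihilate_smul, annihilate_expVec, smul_smul]
    ring_nf

lemma iterate_annihilate_expVec (t : ℝ) (u : ℝ → ℂ) (a : ℕ) :
    (annihilate t)^[a] (expVec u) = u t ^ a • expVec u := by
  simpa using iterate_annihilate_smul_expVec t u 1 a

/-- Constants leave sums and integrals in a field without any convergence assumption. -/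
lemma fockInner_smul_smul (c d : ℂ) (ψ φ : FockVec) :
    fockInner (c • ψ) (d • φ) = conj c * d * fockInner ψ φ := by
  simp only [fockInner, ← tsum_mul_left, ← integral_const_mul, Pi.smul_apply, smul_eq_mul, map_mul]
  exact tsum_congr fun n => congrArg _ (funext fun s => by ring)

/-! ### Locally bounded functions and test functions -/

/-- Measurable functions that are bounded on bounded sets. -/
def LocBdd (G : ℝ → ℂ) : Prop :=
  Measurable G ∧ ∀ R : ℝ, ∃ C : ℝ, ∀ t : ℝ, |t| ≤ R → ‖G t‖ ≤ C

/-- Bounded measurable functions with bounded support that vanish at `0`. -/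
structure IsTest (f : ℝ → ℂ) : Prop where
  measurable : Measurable f
  bounded : ∃ C : ℝ, ∀ t, ‖f t‖ ≤ C
  support : ∃ R : ℝ, ∀ t, R < |t| → f t = 0
  zero : f 0 = 0

namespace LocBdd

variable {F G : ℝ → ℂ}

lemma const (c : ℂ) : LocBdd fun _ => c := ⟨measurable_const, fun _ => ⟨‖c‖, by simp⟩⟩

lemma mul (hF : LocBdd F) (hG : LocBdd G) : LocBdd fun t => F t * G t := by
  refine ⟨hF.1.mul hG.1, fun R => ?_⟩
  obtain ⟨C, hC⟩ := hF.2 R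
  obtain ⟨D, hD⟩ := hG.2 R
  refine ⟨C * D, fun t ht => ?_⟩
  rw [norm_mul]
  exact mul_le_mul (hC t ht) (hD t ht) (norm_nonneg _) ((norm_nonneg _).trans (hC t ht))

lemma add (hF : LocBdd F) (hG : LocBdd G) : LocBdd fun t => F t + G t := by
  refine ⟨hF.1.add hG.1, fun R => ?_⟩
  obtain ⟨C, hC⟩ := hF.2 R
  obtain ⟨D, hD⟩ := hG.2 R
  exact ⟨C + D, fun t ht => (norm_add_le _ _).trans (add_le_add (hC t ht) (hD t ht))⟩

lemma sub (hF : LocBdd F) (hG : LocBdd G) : LocBdd fun t => F t - G t := by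
  simpa [sub_eq_add_neg] using hF.add ((const (-1)).mul hG)

lemma div_const (hF : LocBdd F) (c : ℂ) : LocBdd fun t => F t / c := by
  simpa [div_eq_mul_inv] using hF.mul (const c⁻¹)

lemma pow (hF : LocBdd F) (n : ℕ) : LocBdd fun t => F t ^ n := by
  induction n with
  | zero => simpa using const 1
  | succ n ih => simpa [pow_succ] using ih.mul hF

lemma conj_comp (hF : LocBdd F) : LocBdd fun t => conj (F t) :=
  ⟨Complex.continuous_conj.measurable.comp hF.1, fun R => by simpa using hF.2 R⟩

lemma exp_comp (hF : LocBdd F) : LocBdd fun t => Complex.exp (F t) := by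
  refine ⟨Complex.measurable_exp.comp hF.1, fun R => ?_⟩
  obtain ⟨C, hC⟩ := hF.2 R
  exact ⟨Real.exp C, fun t ht =>
    (Complex.norm_exp_le_exp_norm _).trans (Real.exp_le_exp.2 (hC t ht))⟩

end LocBdd

lemma IsExpArg.locBdd {u : ℝ → ℂ} (hu : IsExpArg u) : LocBdd u := ⟨hu.1, hu.2.2⟩

namespace IsTest

variable {f h : ℝ → ℂ}

lemma mul (hf : IsTest f) (hh : IsTest h) : IsTest fun t => f t * h t where
  measurable := hf.measurable.mul hh.measurable
  bounded := by
    obtain ⟨C, hC⟩ := hf.bounded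
    obtain ⟨D, hD⟩ := hh.bounded
    refine ⟨C * D, fun t => ?_⟩
    rw [norm_mul]
    exact mul_le_mul (hC t) (hD t) (norm_nonneg _) ((norm_nonneg _).trans (hC t))
  support := by
    obtain ⟨R, hR⟩ := hf.support
    exact ⟨R, fun t ht => by simp [hR t ht]⟩
  zero := by simp [hf.zero]

lemma star (hf : IsTest f) : IsTest fun t => star (f t) where
  measurable := Complex.continuous_conj.measurable.comp hf.measurable
  bounded := by simpa using hf.bounded
  support := by simpa using hf.support
  zero := by simp [hf.zero]

lemma integrable (hf : IsTest f) : Integrable f := by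
  obtain ⟨C, hC⟩ := hf.bounded
  obtain ⟨R, hR⟩ := hf.support
  have h : IntegrableOn f (Set.Icc (-R) R) :=
    Measure.integrableOn_of_bounded (M := C) (by simp) hf.measurable.aestronglyMeasurable
      (Filter.Eventually.of_forall hC)
  refine (integrableOn_iff_integrable_of_support_subset fun t ht => ?_).1 h
  by_contra hn
  refine ht (hR t ?_)
  rw [Set.mem_Icc, ← abs_le] at hn
  exact not_le.1 hn

lemma exists_norm_le_of_ne_zero (hf : IsTest f) {G : ℝ → ℂ} (hG : LocBdd G) :
    ∃ C, ∀ t, f t ≠ 0 → ‖G t‖ ≤ C := by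
  obtain ⟨R, hR⟩ := hf.support
  obtain ⟨C, hC⟩ := hG.2 R
  exact ⟨C, fun t ht => hC t (not_lt.1 fun h => ht (hR t h))⟩

lemma integrable_mul (hf : IsTest f) {G : ℝ → ℂ} (hG : LocBdd G) :
    Integrable fun t => f t * G t := by
  obtain ⟨C, hC⟩ := hf.exists_norm_le_of_ne_zero hG
  refine (hf.integrable.norm.mul_const C).mono'
    (hf.measurable.mul hG.1).aestronglyMeasurable (Filter.Eventually.of_forall fun t => ?_)
  rw [norm_mul]
  by_cases h0 : f t = 0
  · simp [h0]
  · exact mul_le_mul_of_nonneg_left (hC t h0) (norm_nonneg _)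

/-- Termwise integration of a series that converges absolutely, uniformly on the support of the
test function. -/
lemma hasSum_integral (hf : IsTest f) {ι : Type} [Countable ι] {F : ι → ℝ → ℂ} {G : ℝ → ℂ}
    {c : ι → ℝ} (hF : ∀ i, LocBdd (F i)) (hc : Summable c)
    (hb : ∀ i t, f t ≠ 0 → ‖F i t‖ ≤ c i) (hG : ∀ t, HasSum (fun i => F i t) (G t)) :
    HasSum (fun i => ∫ t, f t * F i t) (∫ t, f t * G t) := by
  have hle (i : ι) (t : ℝ) : ‖f t * F i t‖ ≤ ‖f t‖ * c i := by
    rw [norm_mul]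
    by_cases h0 : f t = 0
    · simp [h0]
    · exact mul_le_mul_of_nonneg_left (hb i t h0) (norm_nonneg _)
  have hsum : Summable fun i => ∫ t, ‖f t * F i t‖ := by
    refine Summable.of_nonneg_of_le (fun i => integral_nonneg fun t => norm_nonneg _)
      (fun i => ?_) (hc.mul_left (∫ t, ‖f t‖))
    rw [← integral_mul_const]
    exact integral_mono (hf.integrable_mul (hF i)).norm (hf.integrable.norm.mul_const _) (hle i)
  have := hasSum_integral_of_summable_integral_norm (fun i => hf.integrable_mul (hF i)) hsum
  simpa only [((hG _).mul_left _).tsum_eq] using this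

end IsTest

lemma IsRightContStep.isTest {f : ℝ → ℂ} (hf : IsRightContStep f) (h0 : f 0 = 0) : IsTest f := by
  suffices h : Measurable f ∧ (∃ C : ℝ, ∀ t, ‖f t‖ ≤ C) ∧ ∃ R : ℝ, ∀ t, R < |t| → f t = 0 from
    ⟨h.1, h.2.1, h.2.2, h0⟩
  clear h0
  rw [IsRightContStep] at hf
  induction hf using Submodule.span_induction with
  | mem g hg =>
    obtain ⟨a, b, rfl⟩ := hg
    refine ⟨measurable_const.indicator measurableSet_Ico, ⟨1, fun t => ?_⟩,
      ⟨max |a| |b|, fun t ht => ?_⟩⟩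
    · exact (norm_indicator_le_norm_self _ _).trans (by simp)
    · refine Set.indicator_of_notMem (fun h => ?_) _
      exact absurd (abs_le_max_abs_abs h.1 h.2.le) (not_le.2 ht)
  | zero => exact ⟨measurable_const, ⟨0, by simp⟩, ⟨0, by simp⟩⟩
  | add g h _ _ hg hh =>
    obtain ⟨mg, ⟨C, hC⟩, R, hR⟩ := hg
    obtain ⟨mh, ⟨D, hD⟩, S, hS⟩ := hh
    refine ⟨mg.add mh, ⟨C + D, fun t => (norm_add_le _ _).trans (add_le_add (hC t) (hD t))⟩,
      max R S, fun t ht => ?_⟩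
    rw [max_lt_iff] at ht
    simp [hR t ht.1, hS t ht.2]
  | smul c g _ hg =>
    obtain ⟨mg, ⟨C, hC⟩, R, hR⟩ := hg
    refine ⟨mg.const_smul c, ⟨‖c‖ * C, fun t => ?_⟩, R, fun t ht => by simp [hR t ht]⟩
    rw [Pi.smul_apply, norm_smul]
    exact mul_le_mul_of_nonneg_left (hC t) (norm_nonneg _)

/-! ### Summation of the exponential series -/

lemma hasSum_pow_div_factorial (z : ℂ) :
    HasSum (fun p : ℕ => z ^ p / p.factorial) (Complex.exp z) := by
  rw [Complex.exp_eq_exp_ℂ]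
  exact NormedSpace.expSeries_div_hasSum_exp z

/-- The termwise derivative of the exponential series: its zeroth term vanishes and the rest is the
series shifted by one. -/
lemma hasSum_mul_pow_div_factorial (z : ℂ) :
    HasSum (fun p : ℕ => p * z ^ (p - 1) / p.factorial) (Complex.exp z) := by
  rw [← hasSum_nat_add_iff' 1]
  have h (p : ℕ) : ((p + 1 : ℕ) : ℂ) * z ^ (p + 1 - 1) / (p + 1).factorial =
      z ^ p / p.factorial := by
    rw [Nat.factorial_succ, Nat.cast_mul, Nat.add_sub_cancel,
      mul_div_mul_left _ _ (by exact_mod_cast p.succ_ne_zero)]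
  simp only [h]
  simpa using hasSum_pow_div_factorial z

lemma hasSum_mul_prod {ι κ : Type} {F : ι → ℂ} {G : κ → ℂ} {s t : ℂ} (hF : HasSum F s)
    (hG : HasSum G t) : HasSum (fun r : ι × κ => F r.1 * G r.2) (s * t) :=
  hF.mul hG (summable_mul_of_summable_norm hF.summable.norm hG.summable.norm)

lemma hasSum_expTerms (a : ℕ) (z m : ℂ) :
    HasSum (expTerms a z m) (Complex.exp z * Complex.exp z * m ^ a) := by
  refine ((hasSum_mul_prod (hasSum_pow_div_factorial z) (hasSum_pow_div_factorial z)).mul_right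
    (m ^ a)).congr_fun fun pq => ?_
  rw [WhiteNoise.expTerms]
  ring

lemma hasSum_expTermsDeriv (a : ℕ) (κ μ z m : ℂ) :
    HasSum (expTermsDeriv a κ μ z m)
      (Complex.exp z * Complex.exp z * (2 * κ * m ^ a + μ * a * m ^ (a - 1))) := by
  have h := hasSum_pow_div_factorial z
  have h' := hasSum_mul_pow_div_factorial z
  have hs := (((hasSum_mul_prod h' h).mul_left (κ * m ^ a)).add
    ((hasSum_mul_prod h h').mul_left (κ * m ^ a))).add
    ((hasSum_mul_prod h h).mul_left (μ * a * m ^ (a - 1)))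
  rw [show Complex.exp z * Complex.exp z * (2 * κ * m ^ a + μ * a * m ^ (a - 1)) =
    κ * m ^ a * (Complex.exp z * Complex.exp z) + κ * m ^ a * (Complex.exp z * Complex.exp z) +
      μ * a * m ^ (a - 1) * (Complex.exp z * Complex.exp z) by ring]
  exact hs

/-- The terms at bounds `Z`, `M` valid on the support of a test function serve as the summable
majorant. -/
lemma norm_expTerms_le {a : ℕ} {z m : ℂ} {Z M : ℝ} (hz : ‖z‖ ≤ Z) (hm : ‖m‖ ≤ M) (pq : ℕ × ℕ) :
    ‖expTerms a z m pq‖ ≤ ‖expTerms a Z M pq‖ := by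
  have hZ : ‖z‖ ≤ ‖(Z : ℂ)‖ := by simpa using hz.trans (le_abs_self Z)
  have hM : ‖m‖ ≤ ‖(M : ℂ)‖ := by simpa using hm.trans (le_abs_self M)
  simp only [expTerms, norm_mul, norm_div, norm_pow]
  gcongr

lemma norm_expTermsDeriv_le {a : ℕ} {κ μ z m : ℂ} {Z M : ℝ} (hz : ‖z‖ ≤ Z) (hm : ‖m‖ ≤ M)
    (pq : ℕ × ℕ) :
    ‖expTermsDeriv a κ μ z m pq‖ ≤ ‖expTermsDeriv a ‖κ‖ ‖μ‖ Z M pq‖ := by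
  have hZ0 := (norm_nonneg _).trans hz
  have hM0 := (norm_nonneg _).trans hm
  have h : expTermsDeriv a ‖κ‖ ‖μ‖ Z M pq = ((
      ‖κ‖ * M ^ a * ((pq.1 * Z ^ (pq.1 - 1) / pq.1.factorial) * (Z ^ pq.2 / pq.2.factorial)) +
      ‖κ‖ * M ^ a * ((Z ^ pq.1 / pq.1.factorial) * (pq.2 * Z ^ (pq.2 - 1) / pq.2.factorial)) +
      ‖μ‖ * a * M ^ (a - 1) * ((Z ^ pq.1 / pq.1.factorial) * (Z ^ pq.2 / pq.2.factorial)) : ℝ) :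
        ℂ) := by
    simp [expTermsDeriv]
  rw [h, Complex.norm_real, Real.norm_of_nonneg (by positivity), expTermsDeriv]
  refine (norm_add₃_le).trans ?_
  simp only [norm_mul, norm_div, norm_pow, Complex.norm_natCast]
  gcongr

lemma LocBdd.expTerms {z m : ℝ → ℂ} (hz : LocBdd z) (hm : LocBdd m) (a : ℕ) (pq : ℕ × ℕ) :
    LocBdd fun t => expTerms a (z t) (m t) pq :=
  (((hz.pow _).div_const _).mul (hm.pow _)).mul ((hz.pow _).div_const _)

lemma LocBdd.expTermsDeriv {z m : ℝ → ℂ} (hz : LocBdd z) (hm : LocBdd m) (a : ℕ) (κ μ : ℂ)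
    (pq : ℕ × ℕ) : LocBdd fun t => expTermsDeriv a κ μ (z t) (m t) pq := by
  have h (p : ℕ) := (hz.pow p).div_const p.factorial
  have h' (p : ℕ) := ((LocBdd.const p).mul (hz.pow (p - 1))).div_const p.factorial
  exact ((((const κ).mul (hm.pow a)).mul ((h' _).mul (h _))).add
    (((const κ).mul (hm.pow a)).mul ((h _).mul (h' _)))).add
    (((const (μ * a)).mul (hm.pow (a - 1))).mul ((h _).mul (h _)))

lemma IsTest.hasSum_integral_expTerms {f : ℝ → ℂ} (hf : IsTest f) {z m : ℝ → ℂ} (hz : LocBdd z)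
    (hm : LocBdd m) (a : ℕ) :
    HasSum (fun pq => ∫ t, f t * expTerms a (z t) (m t) pq)
      (∫ t, f t * (Complex.exp (z t) * Complex.exp (z t) * m t ^ a)) := by
  obtain ⟨Z, hZ⟩ := hf.exists_norm_le_of_ne_zero hz
  obtain ⟨M, hM⟩ := hf.exists_norm_le_of_ne_zero hm
  exact hf.hasSum_integral (fun pq => hz.expTerms hm a pq)
    (hasSum_expTerms a Z M).summable.norm
    (fun pq t ht => norm_expTerms_le (hZ t ht) (hM t ht) pq) fun t => hasSum_expTerms _ _ _

lemma IsTest.hasSum_integral_expTermsDeriv_mul {f : ℝ → ℂ} (hf : IsTest f) {z m w l : ℝ → ℂ}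
    (hz : LocBdd z) (hm : LocBdd m) (hw : LocBdd w) (hl : LocBdd l) (a b : ℕ) (κ μ κ' μ' : ℂ) :
    HasSum (fun r : (ℕ × ℕ) × (ℕ × ℕ) => ∫ t, f t *
        (expTermsDeriv a κ μ (z t) (m t) r.1 * expTermsDeriv b κ' μ' (w t) (l t) r.2))
      (∫ t, f t * ((Complex.exp (z t) * Complex.exp (z t) *
          (2 * κ * m t ^ a + μ * a * m t ^ (a - 1))) *
        (Complex.exp (w t) * Complex.exp (w t) *
          (2 * κ' * l t ^ b + μ' * b * l t ^ (b - 1))))) := by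
  obtain ⟨Z, hZ⟩ := hf.exists_norm_le_of_ne_zero hz
  obtain ⟨M, hM⟩ := hf.exists_norm_le_of_ne_zero hm
  obtain ⟨Z', hZ'⟩ := hf.exists_norm_le_of_ne_zero hw
  obtain ⟨M', hM'⟩ := hf.exists_norm_le_of_ne_zero hl
  refine hf.hasSum_integral (fun r => (hz.expTermsDeriv hm a κ μ r.1).mul
    (hw.expTermsDeriv hl b κ' μ' r.2))
    (hasSum_mul_prod (hasSum_expTermsDeriv a ‖κ‖ ‖μ‖ Z M)
      (hasSum_expTermsDeriv b ‖κ'‖ ‖μ'‖ Z' M')).summable.norm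
    (fun r t ht => ?_) fun t =>
      hasSum_mul_prod (hasSum_expTermsDeriv _ _ _ _ _) (hasSum_expTermsDeriv _ _ _ _ _)
  rw [norm_mul, norm_mul]
  exact mul_le_mul (norm_expTermsDeriv_le (hZ t ht) (hM t ht) _)
    (norm_expTermsDeriv_le (hZ' t ht) (hM' t ht) _) (norm_nonneg _) (norm_nonneg _)

/-! ### Symbols of monomials -/

lemma symbol_monomial_one_time (x y : Fin 1 → ℂ) (d : Var (Fin 1) →₀ ℕ) (c : ℂ) :
    symbol x y (MvPolynomial.monomial d c) =
      c * (y 0 ^ d (symCre 0) * x 0 ^ d (symAnn 0) * 0 ^ d (symDelta 0 0)) := by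
  classical
  have h : d.support ⊆ {symCre 0, symAnn 0, symDelta 0 0} := by
    rintro ((i | i) | i) -
    · fin_cases i; simp [symAnn]
    · fin_cases i; simp [symCre]
    · induction i with | _ i j => fin_cases i; fin_cases j; simp [symDelta]
  rw [symbol, MvPolynomial.aeval_monomial, Finsupp.prod_of_support_subset d h _ (by simp),
    Finset.prod_insert (by simp [symCre, symAnn, symDelta]),
    Finset.prod_insert (by simp [symAnn, symDelta]), Finset.prod_singleton]
  simp [symbolPoint, symCre, symAnn, symDelta, mul_assoc]

lemma symbol_monomial_two_times (x y : Fin 2 → ℂ) (d : Var (Fin 2) →₀ ℕ) (c : ℂ) :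
    symbol x y (MvPolynomial.monomial d c) =
      c * ((y 0 ^ d (symCre 0) * x 0 ^ d (symAnn 0) * 0 ^ d (symDelta 0 0)) *
        (y 1 ^ d (symCre 1) * x 1 ^ d (symAnn 1) * 0 ^ d (symDelta 1 1)) *
          0 ^ d (symDelta 0 1)) := by
  classical
  -- Seven symbols suffice, since `δ(t - s)` and `δ(s - t)` are the same one.
  have h : d.support ⊆ {symCre 0, symAnn 0, symDelta 0 0, symCre 1, symAnn 1, symDelta 1 1,
      symDelta 0 1} := by
    rintro ((i | i) | i) -
    · fin_cases i <;> simp [symAnn]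
    · fin_cases i <;> simp [symCre]
    · induction i with | _ i j => fin_cases i <;> fin_cases j <;> simp [symDelta, Sym2.eq_swap]
  rw [symbol, MvPolynomial.aeval_monomial, Finsupp.prod_of_support_subset d h _ (by simp),
    Finset.prod_insert (by simp [symCre, symAnn, symDelta]),
    Finset.prod_insert (by simp [symCre, symAnn, symDelta]),
    Finset.prod_insert (by simp [symCre, symAnn, symDelta]),
    Finset.prod_insert (by simp [symCre, symAnn, symDelta]),
    Finset.prod_insert (by simp [symAnn, symDelta]),
    Finset.prod_insert (by simp [symDelta]), Finset.prod_singleton]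
  simp [symbolPoint, symCre, symAnn, symDelta, mul_assoc]

lemma symbol_pderiv_symDelta_monomial (x y : Fin 2 → ℂ) (d : Var (Fin 2) →₀ ℕ) (c : ℂ) :
    symbol x y (MvPolynomial.pderiv (symDelta 0 1) (MvPolynomial.monomial d c)) =
      c * d (symDelta 0 1) * ((y 0 ^ d (symCre 0) * x 0 ^ d (symAnn 0) * 0 ^ d (symDelta 0 0)) *
        (y 1 ^ d (symCre 1) * x 1 ^ d (symAnn 1) * 0 ^ d (symDelta 1 1)) *
          0 ^ (d (symDelta 0 1) - 1)) := by
  classical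
  rw [MvPolynomial.pderiv_monomial, symbol_monomial_two_times]
  simp [Finsupp.tsub_apply, symDelta, symCre, symAnn]

/-! ### Quadratic forms on exponential vectors -/

section forms

variable {f h u v : ℝ → ℂ}

/-- The Dirac mass sees only `φ 0 = 0`. With `0 ^ 0 = 1`, the factor `0 ^ m` covers both cases and
matches deltas set to `0` in a symbol. -/
lemma integral_renormFactor_eq {φ : ℝ → ℂ} (h0 : φ 0 = 0) (m : ℕ) :
    ∫ t, φ t ∂(renormFactor m) = ∫ t, φ t * 0 ^ m := by
  rcases eq_or_ne m 0 with rfl | hm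
  · simp [renormFactor]
  · simp [renormFactor, hm, h0]

lemma monomialForm₁_expVec (hf : f 0 = 0) (d : Var (Fin 1) →₀ ℕ) :
    monomialForm₁ f (expVec u) (expVec v) d =
      fockInner (expVec u) (expVec v) * ∫ t, f t *
        symbol (fun _ => v t) (fun _ => conj (u t)) (MvPolynomial.monomial d 1) := by
  rw [monomialForm₁, integral_renormFactor_eq (by simp [hf]), ← integral_const_mul]
  refine congrArg _ (funext fun t => ?_)
  rw [iterate_annihilate_expVec, iterate_annihilate_expVec, fockInner_smul_smul,
    symbol_monomial_one_time, map_pow]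
  ring

lemma twoTimeForm_expVec (d : Var (Fin 2) →₀ ℕ) (t s : ℝ) :
    twoTimeForm (expVec u) (expVec v) d t s =
      (conj (u t) ^ d (symCre 0) * v t ^ d (symAnn 0)) *
        (conj (u s) ^ d (symCre 1) * v s ^ d (symAnn 1)) * fockInner (expVec u) (expVec v) := by
  rw [twoTimeForm, iterate_annihilate_expVec, iterate_annihilate_expVec,
    iterate_annihilate_smul_expVec, iterate_annihilate_smul_expVec, fockInner_smul_smul]
  simp only [map_mul, map_pow]
  ring

lemma monomialForm₂_expVec (hf : f 0 = 0) (hh : h 0 = 0) (d : Var (Fin 2) →₀ ℕ) :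
    monomialForm₂ f h (expVec u) (expVec v) d =
      fockInner (expVec u) (expVec v) * ((∫ t, ∫ s, f t * h s *
        symbol ![v t, v s] ![conj (u t), conj (u s)] (MvPolynomial.monomial d 1)) +
      ∫ s, f s * h s * symbol ![v s, v s] ![conj (u s), conj (u s)]
        (MvPolynomial.pderiv (symDelta 0 1) (MvPolynomial.monomial d 1))) := by
  simp only [symbol_monomial_two_times, symbol_pderiv_symDelta_monomial, Matrix.cons_val_zero,
    Matrix.cons_val_one]
  rw [monomialForm₂]
  -- Let `l` be the exponent of `δ(t - s)`. For `l = 0` the derivative term carries the factor `l =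
  -- 0`; for `l ≥ 1` the double integral carries `0 ^ l = 0`.
  split_ifs with hd
  · have h1 (t : ℝ) := integral_renormFactor_eq
      (φ := fun s => f t * h s * twoTimeForm (expVec u) (expVec v) d t s) (by simp [hh])
      (d (symDelta 1 1))
    simp only [h1]
    rw [integral_renormFactor_eq (by simp [hf])]
    simp only [← integral_mul_const, hd]
    rw [mul_add, ← integral_const_mul]
    simp only [← integral_const_mul, twoTimeForm_expVec]
    simp only [Nat.cast_zero, mul_zero, zero_mul, integral_zero, add_zero, pow_zero]
    refine congrArg _ (funext fun t => congrArg _ (funext fun s => ?_))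
    ring
  · rw [integral_renormFactor_eq (by simp [hf])]
    simp only [zero_pow hd, mul_zero, integral_zero, zero_add]
    rw [← integral_const_mul]
    refine congrArg _ (funext fun s => ?_)
    rw [twoTimeForm_expVec]
    obtain ⟨l, hl⟩ := Nat.exists_eq_succ_of_ne_zero hd
    rw [hl, Nat.succ_eq_add_one, ← add_assoc, Nat.add_sub_cancel, Nat.add_sub_cancel, pow_add,
      pow_add]
    -- Now `l + 1` is the exponent: a single `δ(t - s)` has derivative coefficient `1`, and higher
    -- powers vanish on both sides.
    rcases eq_or_ne l 0 with rfl | hl0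
    · push_cast
      ring
    · simp [zero_pow hl0]

lemma exprForm₁_expVec (hf : IsTest f) (hu : LocBdd u) (hv : LocBdd v) (P : NormalExpr (Fin 1)) :
    exprForm₁ f P (expVec u) (expVec v) =
      fockInner (expVec u) (expVec v) * ∫ t, f t *
        symbol (fun _ => v t) (fun _ => conj (u t)) P := by
  have hP (x y : Fin 1 → ℂ) : symbol x y P =
      ∑ d ∈ P.support, P.coeff d * symbol x y (MvPolynomial.monomial d 1) := by
    conv_lhs => rw [P.as_sum, map_sum]
    exact Finset.sum_congr rfl fun d _ => by simp [symbol_monomial_one_time]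
  simp only [hP, exprForm₁, Finset.mul_sum, monomialForm₁_expVec hf.zero]
  rw [integral_finsetSum, Finset.mul_sum]
  · refine Finset.sum_congr rfl fun d _ => ?_
    simp only [mul_left_comm (f _), integral_const_mul]
    ring
  · intro d _
    simp only [symbol_monomial_one_time]
    exact hf.integrable_mul ((LocBdd.const _).mul ((LocBdd.const _).mul
      (((hu.conj_comp.pow _).mul (hv.pow _)).mul (LocBdd.const _))))

lemma exprForm₂_expVec (hf : IsTest f) (hh : IsTest h) (hu : LocBdd u) (hv : LocBdd v)
    (P : NormalExpr (Fin 2)) :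
    exprForm₂ f h P (expVec u) (expVec v) =
      fockInner (expVec u) (expVec v) * ((∫ t, ∫ s, f t * h s *
        symbol ![v t, v s] ![conj (u t), conj (u s)] P) +
      ∫ s, f s * h s * symbol ![v s, v s] ![conj (u s), conj (u s)]
        (MvPolynomial.pderiv (symDelta 0 1) P)) := by
  have hP (x y : Fin 2 → ℂ) : symbol x y P =
      ∑ d ∈ P.support, P.coeff d * symbol x y (MvPolynomial.monomial d 1) := by
    conv_lhs => rw [P.as_sum, map_sum]
    exact Finset.sum_congr rfl fun d _ => by simp [symbol_monomial_two_times]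
  have hP' (x y : Fin 2 → ℂ) : symbol x y (MvPolynomial.pderiv (symDelta 0 1) P) =
      ∑ d ∈ P.support, P.coeff d * symbol x y
        (MvPolynomial.pderiv (symDelta 0 1) (MvPolynomial.monomial d 1)) := by
    conv_lhs => rw [P.as_sum, map_sum, map_sum]
    exact Finset.sum_congr rfl fun d _ => by
      rw [symbol_pderiv_symDelta_monomial, symbol_pderiv_symDelta_monomial]; ring
  have hM (d : Var (Fin 2) →₀ ℕ) (i : Fin 2) : LocBdd fun t =>
      conj (u t) ^ d (symCre i) * v t ^ d (symAnn i) * 0 ^ d (symDelta i i) :=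
    ((hu.conj_comp.pow _).mul (hv.pow _)).mul (LocBdd.const _)
  -- Each monomial separates into a function of `t` times a function of `s`, so integrability is
  -- only needed in one variable at a time.
  have hsep (d : Var (Fin 2) →₀ ℕ) (t s : ℝ) : f t * h s * (P.coeff d *
      symbol ![v t, v s] ![conj (u t), conj (u s)] (MvPolynomial.monomial d 1)) =
      (f t * (P.coeff d * 0 ^ d (symDelta 0 1) *
        (conj (u t) ^ d (symCre 0) * v t ^ d (symAnn 0) * 0 ^ d (symDelta 0 0)))) *
      (h s * (conj (u s) ^ d (symCre 1) * v s ^ d (symAnn 1) * 0 ^ d (symDelta 1 1))) := by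
    simp only [symbol_monomial_two_times, Matrix.cons_val_zero, Matrix.cons_val_one]
    ring
  have h1 : ∫ t, ∫ s, f t * h s * symbol ![v t, v s] ![conj (u t), conj (u s)] P =
      ∑ d ∈ P.support, P.coeff d * ∫ t, ∫ s, f t * h s *
        symbol ![v t, v s] ![conj (u t), conj (u s)] (MvPolynomial.monomial d 1) := by
    have hin (t : ℝ) : ∫ s, f t * h s * symbol ![v t, v s] ![conj (u t), conj (u s)] P =
        ∑ d ∈ P.support, ∫ s, f t * h s * (P.coeff d *
          symbol ![v t, v s] ![conj (u t), conj (u s)] (MvPolynomial.monomial d 1)) := by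
      simp only [hP, Finset.mul_sum]
      refine integral_finsetSum _ fun d _ => ?_
      simp only [hsep]
      exact (hh.integrable_mul (hM d 1)).const_mul _
    simp only [hin]
    rw [integral_finsetSum]
    · refine Finset.sum_congr rfl fun d _ => ?_
      simp only [mul_left_comm _ (P.coeff d), integral_const_mul]
    · intro d _
      simp only [hsep, integral_const_mul]
      exact (hf.integrable_mul ((LocBdd.const _).mul (hM d 0))).mul_const _
  have h2 : ∫ s, f s * h s * symbol ![v s, v s] ![conj (u s), conj (u s)]
        (MvPolynomial.pderiv (symDelta 0 1) P) =
      ∑ d ∈ P.support, P.coeff d * ∫ s, f s * h s * symbol ![v s, v s] ![conj (u s), conj (u s)]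
        (MvPolynomial.pderiv (symDelta 0 1) (MvPolynomial.monomial d 1)) := by
    simp only [hP', Finset.mul_sum]
    rw [integral_finsetSum]
    · refine Finset.sum_congr rfl fun d _ => ?_
      simp only [mul_left_comm _ (P.coeff d), integral_const_mul]
    · intro d _
      simp only [symbol_pderiv_symDelta_monomial, Matrix.cons_val_zero, Matrix.cons_val_one]
      exact (hf.mul hh).integrable_mul ((LocBdd.const _).mul ((LocBdd.const _).mul
        (((hM d 0).mul (hM d 1)).mul (LocBdd.const _))))
  rw [h1, h2, ← Finset.sum_add_distrib, Finset.mul_sum, exprForm₂]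
  refine Finset.sum_congr rfl fun d _ => ?_
  rw [monomialForm₂_expVec hf.zero hh.zero]
  ring

/-! ### The terms of the expansions and their sums -/

lemma BhatTerm_expVec (hf : IsTest f) (hu : LocBdd u) (hv : LocBdd v) (n : ℕ) (k : ℤ)
    (pq : ℕ × ℕ) :
    BhatTerm n k f (expVec u) (expVec v) pq = fockInner (expVec u) (expVec v) *
      ∫ t, f t * expTerms (n - 1) (k / 2 * (v t - conj (u t))) ((v t + conj (u t)) / 2) pq := by
  simp only [BhatTerm, exprForm₁_expVec hf hu hv, symbol_normalOrder,
    letterEval_densityTerm_complex]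

lemma BhatMulTerm_expVec (hf : IsTest f) (hh : IsTest h) (hu : LocBdd u) (hv : LocBdd v) (n N : ℕ)
    (k K : ℤ) (r : (ℕ × ℕ) × (ℕ × ℕ)) :
    BhatMulTerm n k f N K h (expVec u) (expVec v) r = fockInner (expVec u) (expVec v) *
      ((∫ t, f t *
          expTerms (n - 1) (k / 2 * (v t - conj (u t))) ((v t + conj (u t)) / 2) r.1) *
        (∫ t, h t *
          expTerms (N - 1) (K / 2 * (v t - conj (u t))) ((v t + conj (u t)) / 2) r.2) +
      ∫ t, f t * h t *
        (expTermsDeriv (n - 1) (k / 2) (1 / 2) (k / 2 * (v t - conj (u t)))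
          ((v t + conj (u t)) / 2) r.1 *
        expTermsDeriv (N - 1) (-(K / 2)) (1 / 2) (K / 2 * (v t - conj (u t)))
          ((v t + conj (u t)) / 2) r.2)) := by
  simp only [BhatMulTerm, exprForm₂_expVec hf hh hu hv, symbol_normalOrder, map_mul,
    letterEval_densityTerm_complex, symbol_pderiv_symDelta_normalOrder, Matrix.cons_val_zero,
    Matrix.cons_val_one, mul_mul_mul_comm (f _) (h _) (expTerms _ _ _ _) (expTerms _ _ _ _),
    integral_const_mul, integral_mul_const]

lemma hasSum_BhatTerm (hf : IsTest f) (hu : LocBdd u) (hv : LocBdd v) (n : ℕ) (k : ℤ) :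
    HasSum (BhatTerm n k f (expVec u) (expVec v)) (fockInner (expVec u) (expVec v) *
      ∫ t, f t * (Complex.exp (k / 2 * (v t - conj (u t))) *
        Complex.exp (k / 2 * (v t - conj (u t))) * ((v t + conj (u t)) / 2) ^ (n - 1))) := by
  rw [show BhatTerm n k f (expVec u) (expVec v) = _ from funext (BhatTerm_expVec hf hu hv n k)]
  exact (hf.hasSum_integral_expTerms ((LocBdd.const _).mul (hv.sub hu.conj_comp))
    ((hv.add hu.conj_comp).div_const 2) (n - 1)).mul_left _

lemma hasSum_BhatMulTerm (hf : IsTest f) (hh : IsTest h) (hu : LocBdd u) (hv : LocBdd v)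
    (n N : ℕ) (k K : ℤ) :
    HasSum (BhatMulTerm n k f N K h (expVec u) (expVec v)) (fockInner (expVec u) (expVec v) *
      ((∫ t, f t * (Complex.exp (k / 2 * (v t - conj (u t))) *
          Complex.exp (k / 2 * (v t - conj (u t))) * ((v t + conj (u t)) / 2) ^ (n - 1))) *
        (∫ t, h t * (Complex.exp (K / 2 * (v t - conj (u t))) *
          Complex.exp (K / 2 * (v t - conj (u t))) * ((v t + conj (u t)) / 2) ^ (N - 1))) +
      ∫ t, f t * h t *
        ((Complex.exp (k / 2 * (v t - conj (u t))) * Complex.exp (k / 2 * (v t - conj (u t))) *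
          (2 * (k / 2) * ((v t + conj (u t)) / 2) ^ (n - 1) +
            1 / 2 * (n - 1 : ℕ) * ((v t + conj (u t)) / 2) ^ (n - 1 - 1))) *
        (Complex.exp (K / 2 * (v t - conj (u t))) * Complex.exp (K / 2 * (v t - conj (u t))) *
          (2 * -(K / 2) * ((v t + conj (u t)) / 2) ^ (N - 1) +
            1 / 2 * (N - 1 : ℕ) * ((v t + conj (u t)) / 2) ^ (N - 1 - 1)))))) := by
  rw [show BhatMulTerm n k f N K h (expVec u) (expVec v) = _ from
    funext (BhatMulTerm_expVec hf hh hu hv n N k K)]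
  have hz (c : ℂ) := (LocBdd.const c).mul (hv.sub hu.conj_comp)
  have hm := (hv.add hu.conj_comp).div_const 2
  exact ((hasSum_mul_prod (hf.hasSum_integral_expTerms (hz _) hm (n - 1))
    (hh.hasSum_integral_expTerms (hz _) hm (N - 1))).add
    ((hf.mul hh).hasSum_integral_expTermsDeriv_mul (hz _) hm (hz _) hm (n - 1) (N - 1)
      _ _ _ _)).mul_left _

/-- The commutator of `B̂ⁿ_k(f)` and `B̂ᴺ_K(h)`: the contributions without `δ(t - s)` cancel and
those with `δ(t - s)` combine to the Poisson bracket of the symbols. -/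
lemma BhatComm_expVec (hf : IsTest f) (hh : IsTest h) (hu : LocBdd u) (hv : LocBdd v)
    {n N : ℕ} (hn : 2 ≤ n) (hN : 2 ≤ N) (k K : ℤ) :
    BhatComm n k f N K h (expVec u) (expVec v) =
      ((k : ℂ) * ((N : ℂ) - 1) - (K : ℂ) * ((n : ℂ) - 1)) *
        Bhat (n + N - 2) (k + K) (fun t => f t * h t) (expVec u) (expVec v) := by
  have hz (c : ℂ) := (LocBdd.const c).mul (hv.sub hu.conj_comp)
  have hm := (hv.add hu.conj_comp).div_const 2
  -- With `n = a + 2` and `N = b + 2` all the truncated exponents become genuine.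
  obtain ⟨a, rfl⟩ := Nat.exists_eq_add_of_le' hn
  obtain ⟨b, rfl⟩ := Nat.exists_eq_add_of_le' hN
  rw [BhatComm, BhatMul, BhatMul, Bhat, (hasSum_BhatMulTerm hf hh hu hv _ _ k K).tsum_eq,
    (hasSum_BhatMulTerm hh hf hu hv _ _ K k).tsum_eq,
    (hasSum_BhatTerm (hf.mul hh) hu hv _ (k + K)).tsum_eq, mul_left_comm, ← mul_sub,
    mul_comm (∫ t, f t * _) (∫ t, h t * _), add_sub_add_left_eq_sub]
  congr 1
  -- Local boundedness of the integrands, needed to merge the two diagonal integrals into one.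
  have hD (k K : ℤ) (μ μ' : ℂ) (a b a' b' : ℕ) : LocBdd fun t =>
      (Complex.exp (k / 2 * (v t - conj (u t))) * Complex.exp (k / 2 * (v t - conj (u t))) *
        (2 * (k / 2) * ((v t + conj (u t)) / 2) ^ a + μ * ((v t + conj (u t)) / 2) ^ a')) *
      (Complex.exp (K / 2 * (v t - conj (u t))) * Complex.exp (K / 2 * (v t - conj (u t))) *
        (2 * -(K / 2) * ((v t + conj (u t)) / 2) ^ b + μ' * ((v t + conj (u t)) / 2) ^ b')) :=
    (((hz _).exp_comp.mul (hz _).exp_comp).mul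
      (((LocBdd.const _).mul (hm.pow _)).add ((LocBdd.const _).mul (hm.pow _)))).mul
    (((hz _).exp_comp.mul (hz _).exp_comp).mul
      (((LocBdd.const _).mul (hm.pow _)).add ((LocBdd.const _).mul (hm.pow _))))
  rw [← integral_sub ((hf.mul hh).integrable_mul (hD ..)) ((hh.mul hf).integrable_mul (hD ..)),
    ← integral_const_mul]
  refine congrArg _ (funext fun t => ?_)
  have e : Complex.exp (((k + K : ℤ) : ℂ) / 2 * (v t - conj (u t))) =
      Complex.exp (k / 2 * (v t - conj (u t))) * Complex.exp (K / 2 * (v t - conj (u t))) := by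
    rw [← Complex.exp_add]
    push_cast
    ring_nf
  rw [e, show a + 2 - 1 = a + 1 from rfl, show b + 2 - 1 = b + 1 from rfl,
    show a + 2 + (b + 2) - 2 - 1 = a + b + 1 by omega, Nat.add_sub_cancel, Nat.add_sub_cancel]
  -- In the bracket the terms with `k * K` and those with `(n - 1) * (N - 1)` cancel; the mixed
  -- terms add up to the structure constant.
  push_cast
  ring

end forms
end WhiteNoise

end

theorem proposition4 (f g : ℝ → ℂ)
    (hf : WhiteNoise.IsRightContStep f) (hg : WhiteNoise.IsRightContStep g)
    (hf0 : f 0 = 0) (hg0 : g 0 = 0) :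
    (∀ (n N : ℕ) (k K : ℤ), 2 ≤ n → 2 ≤ N →
      ∀ u v : ℝ → ℂ, WhiteNoise.IsExpArg u → WhiteNoise.IsExpArg v →
        Summable (WhiteNoise.BhatTerm n k (fun t => star (g t))
          (WhiteNoise.expVec u) (WhiteNoise.expVec v)) ∧
        Summable (WhiteNoise.BhatTerm N K f
          (WhiteNoise.expVec u) (WhiteNoise.expVec v)) ∧
        Summable (WhiteNoise.BhatTerm (n + N - 2) (k + K) (fun t => star (g t) * f t)
          (WhiteNoise.expVec u) (WhiteNoise.expVec v)) ∧
        Summable (WhiteNoise.BhatMulTerm n k (fun t => star (g t)) N K f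
          (WhiteNoise.expVec u) (WhiteNoise.expVec v)) ∧
        Summable (WhiteNoise.BhatMulTerm N K f n k (fun t => star (g t))
          (WhiteNoise.expVec u) (WhiteNoise.expVec v)) ∧
        WhiteNoise.BhatComm n k (fun t => star (g t)) N K f
            (WhiteNoise.expVec u) (WhiteNoise.expVec v) =
          ((k : ℂ) * ((N : ℂ) - 1) - (K : ℂ) * ((n : ℂ) - 1)) *
            WhiteNoise.Bhat (n + N - 2) (k + K) (fun t => star (g t) * f t)
              (WhiteNoise.expVec u) (WhiteNoise.expVec v)) ∧
    (∀ (k K : ℤ) (u v : ℝ → ℂ), WhiteNoise.IsExpArg u → WhiteNoise.IsExpArg v →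
        WhiteNoise.BhatComm 2 k (fun t => star (g t)) 2 K f
            (WhiteNoise.expVec u) (WhiteNoise.expVec v) =
          ((k : ℂ) - (K : ℂ)) *
            WhiteNoise.Bhat 2 (k + K) (fun t => star (g t) * f t)
              (WhiteNoise.expVec u) (WhiteNoise.expVec v)) := by
  have tf := hf.isTest hf0
  have tg := (hg.isTest hg0).star
  refine ⟨fun n N k K hn hN u v hu hv => ?_, fun k K u v hu hv => ?_⟩
  · exact ⟨(WhiteNoise.hasSum_BhatTerm tg hu.locBdd hv.locBdd n k).summable,
      (WhiteNoise.hasSum_BhatTerm tf hu.locBdd hv.locBdd N K).summable,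
      (WhiteNoise.hasSum_BhatTerm (tg.mul tf) hu.locBdd hv.locBdd _ _).summable,
      (WhiteNoise.hasSum_BhatMulTerm tg tf hu.locBdd hv.locBdd n N k K).summable,
      (WhiteNoise.hasSum_BhatMulTerm tf tg hu.locBdd hv.locBdd N n K k).summable,
      WhiteNoise.BhatComm_expVec tg tf hu.locBdd hv.locBdd hn hN k K⟩
  · rw [WhiteNoise.BhatComm_expVec tg tf hu.locBdd hv.locBdd le_rfl le_rfl k K]
    norm_num
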